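/- Let $D$ be a connected (finite-dimensional, real) Lie group with Lie algebra $\mathfrak d$, let $\langle\cdot,\cdot\rangle$ be a non-degenerate symmetric invariant bilinear form on $\mathfrak d$, let $G\subset D$ be a closed connected subgroup whose Lie algebra $\mathfrak g\subset\mathfrak d$ satisfies $\mathfrak g=\mathfrak g^{\perp}$, and let $i:\mathfrak g\to\mathfrak d$ be the inclusion. Equip $S=D/G$ with the smooth structure for which the projection $\pi_0:D\to S$ is a submersion. Let $j:\mathfrak g^*\to\mathfrak d$ be an isotropic splitting, i.e. a linear map with $\langle j(\xi),i(x)\rangle=\xi(x)$ and $\langle j(\xi),j(\eta)\rangle=0$ for all $x\in\mathfrak g$, $\xi,\eta\in\mathfrak g^*$. Assume that $j$ is everywhere admissible: $\mathfrak d=\mathrm{Ad}_d(\mathfrak g)\oplus j(\mathfrak g^*)$ for every $d\in D$. With respect to the isomorphism $\mathfrak g\oplus\mathfrak g^*\cong\mathfrak d$, $(x,\xi)\mapsto i(x)+j(\xi)$, write $$\mathrm{Ad}_d=\begin{pmatrix}\mathbf k(d)&\mathbf b(d)\\ \mathbf c(d)&\mathbf a(d)\end{pmatrix}.$$ Let $\#^{\triangleright}_s:\mathfrak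 d\to T_sS$, $\#^{\triangleright}_s(z)=\frac{d}{dt}\big|_{0}\exp(tz)\triangleright s$, be the infinitesimal action of the dressing action $d\triangleright\pi_0(k)=\pi_0(dk)$, and put $\xi^{\triangleright}=\#^{\triangleright}(j(\xi))$ for $\xi\in\mathfrak g^*$. Let $r\in\mathfrak d\otimes\mathfrak d$ be given by $r(\alpha,\beta)=\langle i^T\alpha,j^T\beta\rangle$ for $\alpha,\beta\in\mathfrak d^*$, let $\Pi^D=r^L-r^R$ (left and right translation along $D$), and let $\Pi^S=-(\#^{\triangleright}\otimes\#^{\triangleright})(r)$ be the quasi-Poisson bivector on $S$. Then the following hold. 1. For every $s\in S$ the map $\mathfrak g^*\to T_sS$, $\xi\mapsto\xi^{\triangleright}_s$, is a linear isomorphism, so that for each $x\in\mathfrak g$ there is a unique $1$-form $x^{\triangleright}$ on $S$ with $x^{\triangleright}(\xi^{\triangleright})=\xi(x)$ for all $\xi\in\mathfrak g^*$. Moreover $\pi_{0*}(\Pi^D)=\Pi^S$. 2. Let $\mathbf\Pi(x,y)=\Pi^S(x^{\triangleright},y^{\triangleright})$ for $x,y\in\mathfrak g$, and view $\mathbf\Pi$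 as a function on $S$ with values in $\mathrm{Hom}(\mathfrak g,\mathfrak g^*)$ through $\mathbf\Pi(y)=\mathbf\Pi(\cdot,y)$. Then $\mathbf k:D\to\mathrm{Hom}(\mathfrak g,\mathfrak g)$, $\mathbf c:D\to\mathrm{Hom}(\mathfrak g,\mathfrak g^*)$ and $\mathbf\Pi:S\to\mathrm{Hom}(\mathfrak g,\mathfrak g^*)$ are smooth, $\mathbf k(d)$ is invertible for every $d\in D$, and $$\mathbf\Pi\circ\pi_0=\mathbf c\cdot\mathbf k^{-1}.$$ -/

import Mathlib

open scoped Manifold ContDiff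

noncomputable section

namespace ManinPair

section LieGroupData

variable {E : Type*} [NormedAddCommGroup E] [NormedSpace ℝ E]
  {D : Type*} [TopologicalSpace D] [ChartedSpace E D] [Group D]

/-- `IsLieSubalgebraOf G g` says that `g` is the Lie algebra of the closed subgroup `G`: it consists
of the `x ∈ T₁D` such that `exp (t x) ∈ G` for all real `t`, where `t ↦ exp (t x)` is the integral
curve through `1` of the left-invariant vector field generated by `x`. -/
def IsLieSubalgebraOf (G : Subgroup D) (g : Submodule ℝ (GroupLieAlgebra 𝓘(ℝ, E) D)) : Prop :=
  ∀ x : GroupLieAlgebra 𝓘(ℝ, E) D, x ∈ g ↔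
    ∃ γ : ℝ → D, γ 0 = 1 ∧
      IsMIntegralCurve (I := 𝓘(ℝ, E)) γ (mulInvariantVectorField x) ∧ ∀ t, γ t ∈ G

/-- `(𝔡, g)` is a Manin pair: `B` is a non-degenerate symmetric invariant bilinear form on the Lie
algebra `𝔡` of `D` and `g` is a subalgebra equal to its own orthogonal complement. -/
structure IsManinPair (B : LinearMap.BilinForm ℝ (GroupLieAlgebra 𝓘(ℝ, E) D))
    (g : Submodule ℝ (GroupLieAlgebra 𝓘(ℝ, E) D)) : Prop where
  symm : ∀ x y, B x y = B y x
  nondegenerate : ∀ x, (∀ y, B x y = 0) → x = 0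
  invariant : ∀ x y z, B ⁅x, y⁆ z = B x ⁅y, z⁆
  subalgebra : ∀ x ∈ g, ∀ y ∈ g, ⁅x, y⁆ ∈ g
  lagrangian : ∀ x, x ∈ g ↔ ∀ y ∈ g, B x y = 0

/-- The adjoint representation: `Ad d` is the differential at `1` of `h ↦ d h d⁻¹`. -/
def Ad (d : D) : GroupLieAlgebra 𝓘(ℝ, E) D →ₗ[ℝ] GroupLieAlgebra 𝓘(ℝ, E) D :=
  (mfderiv 𝓘(ℝ, E) 𝓘(ℝ, E) (fun h : D => d * h * d⁻¹) 1 : E →L[ℝ] E).toLinearMap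

/-- The differential at `1` of the left translation `h ↦ d h`. -/
def leftTranslate (d : D) : GroupLieAlgebra 𝓘(ℝ, E) D →ₗ[ℝ] TangentSpace 𝓘(ℝ, E) d :=
  (mfderiv 𝓘(ℝ, E) 𝓘(ℝ, E) (fun h : D => d * h) 1 : E →L[ℝ] E).toLinearMap

/-- The differential at `1` of the right translation `h ↦ h d`. -/
def rightTranslate (d : D) : GroupLieAlgebra 𝓘(ℝ, E) D →ₗ[ℝ] TangentSpace 𝓘(ℝ, E) d :=
  (mfderiv 𝓘(ℝ, E) 𝓘(ℝ, E) (fun h : D => h * d) 1 : E →L[ℝ] E).toLinearMap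

end LieGroupData

section Algebra

variable {V : Type*} [AddCommGroup V] [Module ℝ V]

/-- The map `q : V → g*`, `q z = ⟨z, i(·)⟩`. -/
def q (B : LinearMap.BilinForm ℝ V) (g : Submodule ℝ V) : V →ₗ[ℝ] Module.Dual ℝ g :=
  g.subtype.dualMap ∘ₗ B

/-- `j` is an isotropic splitting of `0 → g → V → g* → 0`. -/
structure IsIsotropicSplitting (B : LinearMap.BilinForm ℝ V) (g : Submodule ℝ V)
    (j : Module.Dual ℝ g →ₗ[ℝ] V) : Prop where
  q_comp : q B g ∘ₗ j = LinearMap.id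
  isotropic : ∀ ξ η, B (j ξ) (j η) = 0

/-- The linear map `g ⊕ g* → V`, `(x, ξ) ↦ i x + j ξ`. -/
def splitMap (g : Submodule ℝ V) (j : Module.Dual ℝ g →ₗ[ℝ] V) :
    (g × Module.Dual ℝ g) →ₗ[ℝ] V :=
  LinearMap.coprod g.subtype j

theorem splitMap_bijective {B : LinearMap.BilinForm ℝ V} {g : Submodule ℝ V}
    (hg : ∀ x, x ∈ g ↔ ∀ y ∈ g, B x y = 0)
    {j : Module.Dual ℝ g →ₗ[ℝ] V} (hj : IsIsotropicSplitting B g j) :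
    Function.Bijective (splitMap g j) := by
  have hq : ∀ ξ, q B g (j ξ) = ξ := fun ξ => LinearMap.congr_fun hj.q_comp ξ
  have hx : ∀ x : g, q B g (x : V) = 0 := fun x =>
    LinearMap.ext fun y => (hg x).1 x.2 y y.2
  constructor
  · rw [injective_iff_map_eq_zero]
    rintro ⟨x, ξ⟩ h
    have h' : (x : V) + j ξ = 0 := h
    have hξ : ξ = 0 := by
      have := congrArg (q B g) h'
      rwa [map_add, hx, hq, zero_add, map_zero] at this
    subst hξ
    have h0 : (x : V) = 0 := by simpa using h'
    have hx0 : x = 0 := Subtype.ext h0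
    subst hx0
    rfl
  · intro z
    have hz : z - j (q B g z) ∈ g := (hg _).2 fun y hy => by
      have h2 : q B g (z - j (q B g z)) = 0 := by rw [map_sub, hq, sub_self]
      exact LinearMap.congr_fun h2 ⟨y, hy⟩
    exact ⟨(⟨_, hz⟩, q B g z), sub_add_cancel z _⟩

/-- The isomorphism `g ⊕ g* ≅ V` induced by an isotropic splitting. -/
def splitEquiv {B : LinearMap.BilinForm ℝ V} {g : Submodule ℝ V}
    (hg : ∀ x, x ∈ g ↔ ∀ y ∈ g, B x y = 0)
    {j : Module.Dual ℝ g →ₗ[ℝ] V} (hj : IsIsotropicSplitting B g j) :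
    (g × Module.Dual ℝ g) ≃ₗ[ℝ] V :=
  LinearEquiv.ofBijective (splitMap g j) (splitMap_bijective hg hj)

/-- The tensor `r ∈ V ⊗ V`, viewed as a bilinear form on `V*`: `r(α, β) = ⟨iᵀ α, jᵀ β⟩`, where
`iᵀ α ∈ g*` and `jᵀ β ∈ g** = g`. -/
def rMatrix (g : Submodule ℝ V) (j : Module.Dual ℝ g →ₗ[ℝ] V) :
    Module.Dual ℝ V →ₗ[ℝ] Module.Dual ℝ V →ₗ[ℝ] ℝ :=
  j.dualMap.flip ∘ₗ g.subtype.dualMap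

end Algebra

section Blocks

variable {E : Type*} [NormedAddCommGroup E] [NormedSpace ℝ E]
  {D : Type*} [TopologicalSpace D] [ChartedSpace E D] [Group D]
  {B : LinearMap.BilinForm ℝ (GroupLieAlgebra 𝓘(ℝ, E) D)}
  {g : Submodule ℝ (GroupLieAlgebra 𝓘(ℝ, E) D)}
  {j : Module.Dual ℝ g →ₗ[ℝ] GroupLieAlgebra 𝓘(ℝ, E) D}

/-- `Ad d`, read on `g ⊕ g*` through the isomorphism `g ⊕ g* ≅ 𝔡` induced by `j`. -/
def AdSplit (hB : IsManinPair B g) (hj : IsIsotropicSplitting B g j) (d : D) :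
    (g × Module.Dual ℝ g) →ₗ[ℝ] (g × Module.Dual ℝ g) :=
  (splitEquiv hB.lagrangian hj).symm.toLinearMap ∘ₗ Ad d ∘ₗ
    (splitEquiv hB.lagrangian hj).toLinearMap

/-- The top-left block `k(d) : g → g` of `Ad d`. -/
def kBlock (hB : IsManinPair B g) (hj : IsIsotropicSplitting B g j) (d : D) : g →ₗ[ℝ] g :=
  LinearMap.fst ℝ g (Module.Dual ℝ g) ∘ₗ AdSplit hB hj d ∘ₗ LinearMap.inl ℝ g (Module.Dual ℝ g)

/-- The bottom-left block `c(d) : g → g*` of `Ad d`. -/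
def cBlock (hB : IsManinPair B g) (hj : IsIsotropicSplitting B g j) (d : D) :
    g →ₗ[ℝ] Module.Dual ℝ g :=
  LinearMap.snd ℝ g (Module.Dual ℝ g) ∘ₗ AdSplit hB hj d ∘ₗ LinearMap.inl ℝ g (Module.Dual ℝ g)

/-- The tensor field `Π^D = r^L - r^R` on `D`, at the point `d`, as a bilinear form on `T*_d D`. -/
def PiD (j : Module.Dual ℝ g →ₗ[ℝ] GroupLieAlgebra 𝓘(ℝ, E) D) (d : D) :
    Module.Dual ℝ (TangentSpace 𝓘(ℝ, E) d) →ₗ[ℝ]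
      Module.Dual ℝ (TangentSpace 𝓘(ℝ, E) d) →ₗ[ℝ] ℝ :=
  (rMatrix g j).compl₁₂ (leftTranslate d).dualMap (leftTranslate d).dualMap -
    (rMatrix g j).compl₁₂ (rightTranslate d).dualMap (rightTranslate d).dualMap

end Blocks

section Quotient

variable {E : Type*} [NormedAddCommGroup E] [NormedSpace ℝ E]
  {F : Type*} [NormedAddCommGroup F] [NormedSpace ℝ F]
  {D : Type*} [TopologicalSpace D] [ChartedSpace E D] [Group D]
  {G : Subgroup D} [ChartedSpace F (D ⧸ G)]
  {g : Submodule ℝ (GroupLieAlgebra 𝓘(ℝ, E) D)}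

/-- The splitting `j` is admissible at `s`: `𝔡 = Ad_s(g) ⊕ j(g*)`, where `Ad_s(g) = Ad d (g)` for
any `d` over `s`. -/
def IsAdmissibleAt (G : Subgroup D) (j : Module.Dual ℝ g →ₗ[ℝ] GroupLieAlgebra 𝓘(ℝ, E) D)
    (s : D ⧸ G) : Prop :=
  ∀ d : D, (d : D ⧸ G) = s → IsCompl (g.map (Ad d)) (LinearMap.range j)

/-- The differential at `d` of the quotient map `π₀ : D → D ⧸ G`. -/
def dProj (E F : Type*) [NormedAddCommGroup E] [NormedSpace ℝ E]
    [NormedAddCommGroup F] [NormedSpace ℝ F]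
    {D : Type*} [TopologicalSpace D] [ChartedSpace E D] [Group D]
    (G : Subgroup D) [ChartedSpace F (D ⧸ G)] (d : D) :
    TangentSpace 𝓘(ℝ, E) d →ₗ[ℝ] TangentSpace 𝓘(ℝ, F) (d : D ⧸ G) :=
  (mfderiv 𝓘(ℝ, E) 𝓘(ℝ, F) (fun h : D => (h : D ⧸ G)) d).toLinearMap

/-- The infinitesimal dressing action: `x ↦ d/dt|₀ (exp (t x) ▷ s)`, that is, the differential at
`1` of `d ↦ d ▷ s`, where `d ▷ π₀(k) = π₀(d k)`. -/
def dressing (E F : Type*) [NormedAddCommGroup E] [NormedSpace ℝ E]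
    [NormedAddCommGroup F] [NormedSpace ℝ F]
    {D : Type*} [TopologicalSpace D] [ChartedSpace E D] [Group D]
    {G : Subgroup D} [ChartedSpace F (D ⧸ G)] (s : D ⧸ G) :
    GroupLieAlgebra 𝓘(ℝ, E) D →ₗ[ℝ] TangentSpace 𝓘(ℝ, F) s :=
  (mfderiv 𝓘(ℝ, E) 𝓘(ℝ, F) (fun d : D => d • s) 1 : E →L[ℝ] F).toLinearMap

/-- The value at `s` of the vector field `ξ^▷`, as a linear map in `ξ ∈ g*`. -/
def genVec (F : Type*) [NormedAddCommGroup F] [NormedSpace ℝ F] [ChartedSpace F (D ⧸ G)]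
    (j : Module.Dual ℝ g →ₗ[ℝ] GroupLieAlgebra 𝓘(ℝ, E) D) (s : D ⧸ G) :
    Module.Dual ℝ g →ₗ[ℝ] TangentSpace 𝓘(ℝ, F) s :=
  dressing E F s ∘ₗ j

open Classical in
/-- The value at `s` of the `1`-form `x^▷`, as a linear map in `x ∈ g`. When `ξ ↦ ξ^▷_s` is an
isomorphism, it is the unique covector with `x^▷(ξ^▷) = ξ(x)` for all `ξ ∈ g*`; otherwise it is
given the value `0`. -/
def genForm (F : Type*) [NormedAddCommGroup F] [NormedSpace ℝ F] [ChartedSpace F (D ⧸ G)]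
    (j : Module.Dual ℝ g →ₗ[ℝ] GroupLieAlgebra 𝓘(ℝ, E) D) (s : D ⧸ G) :
    g →ₗ[ℝ] Module.Dual ℝ (TangentSpace 𝓘(ℝ, F) s) :=
  if h : Function.Bijective (genVec F j s) then
    (LinearEquiv.ofBijective (genVec F j s) h).symm.toLinearMap.dualMap ∘ₗ Module.Dual.eval ℝ g
  else 0

/-- The tensor field `Π^S` at `s`, obtained by applying minus the infinitesimal dressing action to
`r`, as a bilinear form on `T*_s S`. -/
def PiS (F : Type*) [NormedAddCommGroup F] [NormedSpace ℝ F] [ChartedSpace F (D ⧸ G)]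
    (j : Module.Dual ℝ g →ₗ[ℝ] GroupLieAlgebra 𝓘(ℝ, E) D) (s : D ⧸ G) :
    Module.Dual ℝ (TangentSpace 𝓘(ℝ, F) s) →ₗ[ℝ]
      Module.Dual ℝ (TangentSpace 𝓘(ℝ, F) s) →ₗ[ℝ] ℝ :=
  -((rMatrix g j).compl₁₂ (dressing E F s).dualMap (dressing E F s).dualMap)

/-- The function `Π(x, y) = Π^S(x^▷, y^▷)` at `s`, viewed as the map `g → g*`, `y ↦ Π(·, y)`. -/
def PiMap (F : Type*) [NormedAddCommGroup F] [NormedSpace ℝ F] [ChartedSpace F (D ⧸ G)]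
    (j : Module.Dual ℝ g →ₗ[ℝ] GroupLieAlgebra 𝓘(ℝ, E) D) (s : D ⧸ G) :
    g →ₗ[ℝ] Module.Dual ℝ g :=
  ((PiS F j s).compl₁₂ (genForm F j s) (genForm F j s)).flip

end Quotient

end ManinPair

end

/-! Write `#` for the infinitesimal dressing action at `π₀(d)`, and `L_d`, `R_d` for the
differentials at `1` of the translations by `d`. Everything rests on the kernel of `#`.
Differentiating `h ▷ π₀(d) = π₀(h d)` gives `# = dπ₀ ∘ R_d`, while `R_d ∘ Ad_d = L_d`. The kernel of
`dπ₀ ∘ L_d` is `g` (`dProj_leftTranslate_eq_zero_iff`), so `ker # = Ad_d(g)`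
(`dressing_eq_zero_iff`). Since `π₀` is a submersion, `#` is onto, hence an isomorphism on every
complement of `Ad_d(g)`. Admissibility says that `j(g*)` is one (`genVec_bijective`).

Under `dπ₀` the term `r^L` dies because its first leg lies in `g`, and `-r^R` becomes `Π^S`
(`PiS_eq_PiD`). For the block formula, `#` is applied to `Ad_d w = k w + j(c w)`. The left side
vanishes, so `#(k w) = -(c w)^▷`. Duality turns `Π` into `Π(y)(x) = -x^▷(# y)` (`PiMap_apply`),
whence `Π(k w) = c w`. Finally `Ad` is smooth, hence so are `k`, `c` and `c k⁻¹` on `D`, and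
smoothness of `Π` descends along local sections of `π₀`. -/

/-! ### Submersions, curves with zero velocity, chain rule -/

section SubmersionSection

open Filter Topology

variable {E : Type*} [NormedAddCommGroup E] [NormedSpace ℝ E]
  {F : Type*} [NormedAddCommGroup F] [NormedSpace ℝ F]
  {M : Type*} [TopologicalSpace M] [ChartedSpace E M]
  {N : Type*} [TopologicalSpace N] [ChartedSpace F N]

/-- A submersion has a local section of the same regularity through every point. -/
theorem Manifold.IsSubmersionAt.exists_local_section {n : WithTop ℕ∞}
    [IsManifold 𝓘(ℝ, E) n M] [IsManifold 𝓘(ℝ, F) n N] {f : M → N} {x : M}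
    (h : Manifold.IsSubmersionAt 𝓘(ℝ, E) 𝓘(ℝ, F) n f x) :
    ∃ σ : N → M, σ (f x) = x ∧ ContMDiffAt 𝓘(ℝ, F) 𝓘(ℝ, E) n σ (f x) ∧
      ∀ᶠ y in 𝓝 (f x), f (σ y) = y := by
  let φ := h.domChart
  let ψ := h.codChart
  have hxφ : x ∈ φ.source := h.mem_domChart_source
  have hxψ : f x ∈ ψ.source := h.mem_codChart_source
  let e := h.equiv
  have hw : ∀ u ∈ φ.target, ψ (f (φ.symm u)) = (e u).1 := fun u hu => by
    have hu' : u ∈ (h.domChart.extend 𝓘(ℝ, E)).target := by simpa [φ] using hu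
    simpa using h.writtenInCharts hu'
  have hx0 : e.symm (ψ (f x), (e (φ x)).2) = φ x := by
    have := hw (φ x) (φ.map_source hxφ)
    rw [φ.left_inv hxφ] at this
    rw [this, Prod.mk.eta, e.symm_apply_apply]
  -- In adapted charts `f` is a linear projection. The complementary coordinate is frozen at its
  -- value at `x`, so that the section passes through `x`.
  let τ : N → E := fun y => e.symm (ψ y, (e (φ x)).2)
  have hψ : ContMDiffAt 𝓘(ℝ, F) 𝓘(ℝ, F) n ψ (f x) :=
    contMDiffAt_of_mem_maximalAtlas h.codChart_mem_maximalAtlas hxψ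
  have hτ : ContMDiffAt 𝓘(ℝ, F) 𝓘(ℝ, E) n τ (f x) := by
    have h1 : ContDiff ℝ n (fun u : F => e.symm (u, (e (φ x)).2)) := by fun_prop
    exact h1.contMDiff.contMDiffAt.comp (f x) hψ
  have hτt : τ (f x) ∈ φ.target := by
    change e.symm _ ∈ _
    rw [hx0]; exact φ.map_source hxφ
  refine ⟨fun y => φ.symm (τ y), ?_, ?_, ?_⟩
  · change φ.symm (e.symm _) = x
    rw [hx0, φ.left_inv hxφ]
  · exact (contMDiffAt_symm_of_mem_maximalAtlas h.domChart_mem_maximalAtlas hτt).comp (f x) hτ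
  · filter_upwards [hτ.continuousAt.preimage_mem_nhds (φ.open_target.mem_nhds hτt),
      ψ.open_source.mem_nhds hxψ] with y hy hyψ
    have h1 := hw (τ y) hy
    have h2 : (e (τ y)).1 = ψ y := by simp [τ]
    refine ψ.injOn ?_ hyψ (h1.trans h2)
    exact h.source_subset_preimage_source (φ.map_target hy)

/-- The differential of a submersion is surjective. -/
theorem Manifold.IsSubmersionAt.mfderiv_surjective {n : WithTop ℕ∞} (hn : n ≠ 0)
    [IsManifold 𝓘(ℝ, E) n M] [IsManifold 𝓘(ℝ, F) n N] {f : M → N} {x : M}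
    (h : Manifold.IsSubmersionAt 𝓘(ℝ, E) 𝓘(ℝ, F) n f x) :
    Function.Surjective (mfderiv 𝓘(ℝ, E) 𝓘(ℝ, F) f x) := by
  obtain ⟨σ, hσx, hσ, hfσ⟩ := h.exists_local_section
  intro v
  have h1 : mfderiv 𝓘(ℝ, F) 𝓘(ℝ, F) (f ∘ σ) (f x) =
      ContinuousLinearMap.id ℝ (TangentSpace 𝓘(ℝ, F) (f x)) := by
    rw [← mfderiv_id]
    exact Filter.EventuallyEq.mfderiv_eq hfσ
  have h2 := mfderiv_comp_of_eq (I' := 𝓘(ℝ, E)) (h.contMDiffAt.mdifferentiableAt hn)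
    (hσ.mdifferentiableAt hn) hσx
  rw [h1] at h2
  refine ⟨mfderiv 𝓘(ℝ, F) 𝓘(ℝ, E) σ (f x) v, ?_⟩
  have h3 := DFunLike.congr_fun h2 v
  rw [hσx] at h3
  exact h3.symm

/-- A map out of the target of a surjective submersion is as smooth as its pull-back. -/
theorem Manifold.IsSubmersionAt.contMDiffAt_of_comp {n : WithTop ℕ∞}
    [IsManifold 𝓘(ℝ, E) n M] [IsManifold 𝓘(ℝ, F) n N] {f : M → N} {x : M}
    (h : Manifold.IsSubmersionAt 𝓘(ℝ, E) 𝓘(ℝ, F) n f x)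
    {F' : Type*} [NormedAddCommGroup F'] [NormedSpace ℝ F']
    {P : Type*} [TopologicalSpace P] [ChartedSpace F' P] {u : N → P}
    (hu : ContMDiffAt 𝓘(ℝ, E) 𝓘(ℝ, F') n (u ∘ f) x) :
    ContMDiffAt 𝓘(ℝ, F) 𝓘(ℝ, F') n u (f x) := by
  obtain ⟨σ, hσx, hσ, hfσ⟩ := h.exists_local_section
  have h1 : ContMDiffAt 𝓘(ℝ, F) 𝓘(ℝ, F') n ((u ∘ f) ∘ σ) (f x) :=
    ContMDiffAt.comp_of_eq hu hσ hσx
  refine h1.congr_of_eventuallyEq ?_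
  filter_upwards [hfσ] with y hy
  simp [hy]

/-- A curve with vanishing derivative is constant. -/
theorem eq_of_hasMFDerivAt_zero {c : ℝ → N} [IsManifold 𝓘(ℝ, F) 1 N]
    (hc : ∀ t, HasMFDerivAt 𝓘(ℝ, ℝ) 𝓘(ℝ, F) c t 0) (s t : ℝ) : c s = c t := by
  have hcont : Continuous c := continuous_iff_continuousAt.2 fun t => (hc t).continuousAt
  have hloc : IsLocallyConstant c := by
    rw [IsLocallyConstant.iff_eventually_eq]
    intro t
    -- Near `t` the curve stays in a single chart, where a zero derivative on a ball forces
    -- constancy. Connectedness of `ℝ` then globalises.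
    let φ := chartAt F (c t)
    have hmem : c ⁻¹' φ.source ∈ 𝓝 t :=
      hcont.continuousAt.preimage_mem_nhds (chart_source_mem_nhds F (c t))
    obtain ⟨ε, hε, hball⟩ := Metric.mem_nhds_iff.1 hmem
    have hderiv : ∀ r ∈ Metric.ball t ε, HasFDerivAt (φ ∘ c) (0 : ℝ →L[ℝ] F) r := by
      intro r hr
      have h1 : MDifferentiableAt 𝓘(ℝ, F) 𝓘(ℝ, F) φ (c r) :=
        mdifferentiableAt_atlas (chart_mem_atlas F (c t)) (hball hr)
      have h2 := (h1.hasMFDerivAt.comp r (hc r)).hasFDerivAt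
      have h3 : (mfderiv 𝓘(ℝ, F) 𝓘(ℝ, F) φ (c r)).comp
        (0 : TangentSpace 𝓘(ℝ, ℝ) r →L[ℝ] TangentSpace 𝓘(ℝ, F) (c r)) = 0 :=
        ContinuousLinearMap.comp_zero _
      rw [h3] at h2
      exact h2
    filter_upwards [Metric.ball_mem_nhds t hε] with r hr
    have h4 := Convex.is_const_of_fderivWithin_eq_zero (𝕜 := ℝ) (f := φ ∘ c)
      (convex_ball t ε) (fun y hy => (hderiv y hy).differentiableAt.differentiableWithinAt)
      (fun y hy => (hderiv y hy).hasFDerivWithinAt.fderivWithin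
        (Metric.isOpen_ball.uniqueDiffWithinAt hy)) hr (Metric.mem_ball_self hε)
    exact φ.injOn (hball hr) (hball (Metric.mem_ball_self hε)) h4
  exact hloc.apply_eq_of_preconnectedSpace s t

end SubmersionSection

/-- The chain rule, with the tangent spaces identified with the model spaces. -/
theorem mfderiv_comp_apply_model {E₁ E₂ E₃ : Type*} [NormedAddCommGroup E₁] [NormedSpace ℝ E₁]
    [NormedAddCommGroup E₂] [NormedSpace ℝ E₂] [NormedAddCommGroup E₃] [NormedSpace ℝ E₃]
    {M₁ M₂ M₃ : Type*} [TopologicalSpace M₁] [ChartedSpace E₁ M₁] [TopologicalSpace M₂]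
    [ChartedSpace E₂ M₂] [TopologicalSpace M₃] [ChartedSpace E₃ M₃]
    {f : M₁ → M₂} {u : M₂ → M₃} {h : M₁ → M₃} {x : M₁} {y : M₂}
    (hu : MDifferentiableAt 𝓘(ℝ, E₂) 𝓘(ℝ, E₃) u y) (hf : MDifferentiableAt 𝓘(ℝ, E₁) 𝓘(ℝ, E₂) f x)
    (hy : f x = y) (hh : u ∘ f = h) (v : E₁) :
    (mfderiv 𝓘(ℝ, E₁) 𝓘(ℝ, E₃) h x : E₁ →L[ℝ] E₃) v =
      (mfderiv 𝓘(ℝ, E₂) 𝓘(ℝ, E₃) u y : E₂ →L[ℝ] E₃)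
        ((mfderiv 𝓘(ℝ, E₁) 𝓘(ℝ, E₂) f x : E₁ →L[ℝ] E₂) v) := by
  -- The base point and the composite are variables tied by equations, so that points such as `d *
  -- 1` and `d` are exchanged without transport between tangent spaces.
  subst hy hh
  exact DFunLike.congr_fun (mfderiv_comp x hu hf) v

namespace ManinPair

/-! ### Translations, invariant fields and the adjoint representation -/

section LieGroup

variable {E : Type*} [NormedAddCommGroup E] [NormedSpace ℝ E]
  {D : Type*} [TopologicalSpace D] [ChartedSpace E D] [Group D] [LieGroup 𝓘(ℝ, E) ∞ D]

theorem mdifferentiableAt_mul_left (a h : D) :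
    MDifferentiableAt 𝓘(ℝ, E) 𝓘(ℝ, E) (fun x : D => a * x) h :=
  (contMDiff_mul_left (I := 𝓘(ℝ, E)) (n := ∞)).contMDiffAt.mdifferentiableAt (by simp)

theorem mdifferentiableAt_mul_right (a h : D) :
    MDifferentiableAt 𝓘(ℝ, E) 𝓘(ℝ, E) (fun x : D => x * a) h :=
  (contMDiff_mul_right (I := 𝓘(ℝ, E)) (n := ∞)).contMDiffAt.mdifferentiableAt (by simp)

theorem contMDiff_conj (a : D) :
    ContMDiff 𝓘(ℝ, E) 𝓘(ℝ, E) ∞ (fun x : D => a * x * a⁻¹) :=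
  (contMDiff_mul_right (a := a⁻¹)).comp (contMDiff_mul_left (a := a))

theorem mdifferentiableAt_conj (a h : D) :
    MDifferentiableAt 𝓘(ℝ, E) 𝓘(ℝ, E) (fun x : D => a * x * a⁻¹) h :=
  (contMDiff_conj a).contMDiffAt.mdifferentiableAt (by simp)

theorem leftTranslate_bijective (d : D) :
    Function.Bijective (leftTranslate (E := E) d) := by
  have h1 : (fun x : D => d⁻¹ * x) ∘ (fun x : D => d * x) = id := by ext; simp
  have h2 : (fun x : D => d * x) ∘ (fun x : D => d⁻¹ * x) = id := by ext; simp
  refine ⟨Function.LeftInverse.injective (g := mfderiv 𝓘(ℝ, E) 𝓘(ℝ, E) (fun x : D => d⁻¹ * x) d)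
    fun v => ?_, Function.RightInverse.surjective
      (g := mfderiv 𝓘(ℝ, E) 𝓘(ℝ, E) (fun x : D => d⁻¹ * x) d) fun v => ?_⟩
  · have e1 := mfderiv_comp_apply_model (mdifferentiableAt_mul_left (E := E) d⁻¹ d)
      (mdifferentiableAt_mul_left d 1) (mul_one d) h1 v
    rw [mfderiv_id] at e1
    exact e1.symm
  · have e2 := mfderiv_comp_apply_model (mdifferentiableAt_mul_left (E := E) d 1)
      (mdifferentiableAt_mul_left d⁻¹ d) (inv_mul_cancel d) h2 v
    rw [mfderiv_id] at e2
    exact e2.symm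

theorem rightTranslate_bijective (d : D) :
    Function.Bijective (rightTranslate (E := E) d) := by
  have h1 : (fun x : D => x * d⁻¹) ∘ (fun x : D => x * d) = id := by ext; simp
  have h2 : (fun x : D => x * d) ∘ (fun x : D => x * d⁻¹) = id := by ext; simp
  refine ⟨Function.LeftInverse.injective (g := mfderiv 𝓘(ℝ, E) 𝓘(ℝ, E) (fun x : D => x * d⁻¹) d)
    fun v => ?_, Function.RightInverse.surjective
      (g := mfderiv 𝓘(ℝ, E) 𝓘(ℝ, E) (fun x : D => x * d⁻¹) d) fun v => ?_⟩
  · have e1 := mfderiv_comp_apply_model (mdifferentiableAt_mul_right (E := E) d⁻¹ d)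
      (mdifferentiableAt_mul_right d 1) (one_mul d) h1 v
    rw [mfderiv_id] at e1
    exact e1.symm
  · have e2 := mfderiv_comp_apply_model (mdifferentiableAt_mul_right (E := E) d 1)
      (mdifferentiableAt_mul_right d⁻¹ d) (mul_inv_cancel d) h2 v
    rw [mfderiv_id] at e2
    exact e2.symm

/-- Differentiate `(d h d⁻¹) d = d h` at `h = 1`. -/
theorem rightTranslate_Ad (d : D) (v : GroupLieAlgebra 𝓘(ℝ, E) D) :
    rightTranslate d (Ad d v) = leftTranslate d v :=
  (mfderiv_comp_apply_model (mdifferentiableAt_mul_right (E := E) d 1) (mdifferentiableAt_conj d 1)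
    (by simp) (by ext; simp) v).symm

theorem Ad_injective (d : D) : Function.Injective (Ad (E := E) d) := by
  intro v w h
  apply (leftTranslate_bijective d).1
  rw [← rightTranslate_Ad, h, rightTranslate_Ad]

theorem mfderiv_mul_left_mulInvariantVectorField (a h : D) (v : GroupLieAlgebra 𝓘(ℝ, E) D) :
    mfderiv 𝓘(ℝ, E) 𝓘(ℝ, E) (fun x : D => a * x) h (mulInvariantVectorField v h) =
      mulInvariantVectorField v (a * h) :=
  (mfderiv_comp_apply_model (mdifferentiableAt_mul_left (E := E) a h)
    (mdifferentiableAt_mul_left h 1) (mul_one h) (by ext; simp [mul_assoc]) v).symm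

/-- Left-invariant vector fields are complete. -/
theorem exists_isMIntegralCurve_mulInvariantVectorField [CompleteSpace E] [T2Space D]
    (v : GroupLieAlgebra 𝓘(ℝ, E) D) (x : D) :
    ∃ γ : ℝ → D, γ 0 = x ∧ IsMIntegralCurve (I := 𝓘(ℝ, E)) γ (mulInvariantVectorField v) := by
  have : LieGroup 𝓘(ℝ, E) (minSmoothness ℝ 3) D := .of_le (n := ∞) (by simp; exact ENat.LEInfty.out)
  have : IsManifold 𝓘(ℝ, E) 1 D := .of_le (n := ∞) (by simp)
  have hv : ContMDiff 𝓘(ℝ, E) 𝓘(ℝ, E).tangent 1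
      (fun x : D => (⟨x, mulInvariantVectorField v x⟩ : TangentBundle 𝓘(ℝ, E) D)) :=
    (contMDiff_mulInvariantVectorField v).of_le (by simp)
  obtain ⟨γ, hγ0, hγ⟩ :=
    exists_isMIntegralCurveAt_of_contMDiffAt_boundaryless (t₀ := 0) (hv.contMDiffAt (x := 1))
  rw [isMIntegralCurveAt_iff'] at hγ
  obtain ⟨ε, hε, hγ⟩ := hγ
  rw [Real.ball_eq_Ioo, zero_sub, zero_add] at hγ
  refine exists_isMIntegralCurve_of_isMIntegralCurveOn hv hε (fun y => ?_) x
  -- Left translates of the local curve through `1` are integral curves through every `y`, all with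
  -- the same lifetime `ε`; this uniformity gives completeness.
  refine ⟨fun t => y * γ t, by simp [hγ0], fun t ht => ?_⟩
  have h1 := (mdifferentiableAt_mul_left (E := E) y (γ t)).hasMFDerivAt.comp_hasMFDerivWithinAt t
    (hγ t ht)
  have h2 : (mfderiv 𝓘(ℝ, E) 𝓘(ℝ, E) (fun x : D => y * x) (γ t)).comp
      ((1 : ℝ →L[ℝ] ℝ).smulRight (mulInvariantVectorField v (γ t))) =
      (1 : ℝ →L[ℝ] ℝ).smulRight (mulInvariantVectorField v (y * γ t)) := by
    refine ContinuousLinearMap.ext_ring ?_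
    change mfderiv 𝓘(ℝ, E) 𝓘(ℝ, E) (fun x : D => y * x) (γ t)
      ((1 : ℝ) • mulInvariantVectorField v (γ t)) = (1 : ℝ) • mulInvariantVectorField v (y * γ t)
    rw [one_smul, one_smul, mfderiv_mul_left_mulInvariantVectorField]
  exact h2 ▸ h1

/-- The adjoint representation, with values in the continuous linear endomorphisms of the model
space, is smooth. -/
theorem contMDiff_Ad :
    ContMDiff (M' := E →L[ℝ] E) 𝓘(ℝ, E) 𝓘(ℝ, E →L[ℝ] E) ∞
      (fun d : D => (mfderiv 𝓘(ℝ, E) 𝓘(ℝ, E) (fun h : D => d * h * d⁻¹) 1 : E →L[ℝ] E)) := by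
  intro d₀
  have hf : ContMDiff (𝓘(ℝ, E).prod 𝓘(ℝ, E)) 𝓘(ℝ, E) ∞
      (Function.uncurry fun d h : D => d * h * d⁻¹) :=
    (contMDiff_fst.mul contMDiff_snd).mul contMDiff_fst.inv
  have h1 := ContMDiffAt.mfderiv (m := ∞) (n := ∞) (x₀ := d₀) (fun d h : D => d * h * d⁻¹)
    (fun _ => (1 : D)) hf.contMDiffAt contMDiffAt_const (by simp)
  refine h1.congr_of_eventuallyEq (Filter.Eventually.of_forall fun d => ?_)
  have hone (a : D) : a * 1 * a⁻¹ = 1 := by simp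
  -- `h1` concerns the differential read in tangent bundle coordinates. Conjugation fixes `1`, so
  -- source and target both sit over `1` and the coordinate changes are trivial.
  have hself (p q : D) (hp : p = 1) (hq : q = 1) (w : E) :
      (tangentBundleCore 𝓘(ℝ, E) D).coordChange (achart E p) (achart E q) p w = w := by
    subst hp hq
    exact (tangentBundleCore 𝓘(ℝ, E) D).coordChange_self _ _ (mem_chart_source E (1 : D)) w
  have h2 := inTangentCoordinates_eq (I := 𝓘(ℝ, E)) (I' := 𝓘(ℝ, E)) (x₀ := d₀) (x := d)
    (fun _ : D => (1 : D)) (fun d : D => d * 1 * d⁻¹)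
    (fun d => mfderiv 𝓘(ℝ, E) 𝓘(ℝ, E) (fun h : D => d * h * d⁻¹) 1)
    (mem_chart_source E (1 : D)) (by simp only [hone]; exact mem_chart_source E (1 : D))
  refine Eq.trans (ContinuousLinearMap.ext fun v => ?_) h2.symm
  refine Eq.trans ?_ (hself _ _ (hone d) (hone d₀) _).symm
  exact congrArg (mfderiv 𝓘(ℝ, E) 𝓘(ℝ, E) (fun h : D => d * h * d⁻¹) 1 : E →L[ℝ] E)
    (hself 1 1 rfl rfl v).symm

end LieGroup

/-! ### The quotient map and the dressing action -/

section Quotient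

variable {E : Type*} [NormedAddCommGroup E] [NormedSpace ℝ E]
  {F : Type*} [NormedAddCommGroup F] [NormedSpace ℝ F]
  {D : Type*} [TopologicalSpace D] [ChartedSpace E D] [Group D] [LieGroup 𝓘(ℝ, E) ∞ D]
  {G : Subgroup D} [ChartedSpace F (D ⧸ G)] [IsManifold 𝓘(ℝ, F) ∞ (D ⧸ G)]
  {g : Submodule ℝ (GroupLieAlgebra 𝓘(ℝ, E) D)}
  {j : Module.Dual ℝ g →ₗ[ℝ] GroupLieAlgebra 𝓘(ℝ, E) D}

/-- Composed with the submersion `π₀`, the action of `a` becomes the smooth map `h ↦ π₀(a h)`. -/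
theorem mdifferentiableAt_smul_quotient
    (hproj : Manifold.IsSubmersion 𝓘(ℝ, E) 𝓘(ℝ, F) ∞ (fun d : D => (d : D ⧸ G)))
    (a : D) (s : D ⧸ G) :
    MDifferentiableAt 𝓘(ℝ, F) 𝓘(ℝ, F) (fun s : D ⧸ G => a • s) s := by
  obtain ⟨d, rfl⟩ := QuotientGroup.mk_surjective s
  refine ContMDiffAt.mdifferentiableAt (n := ∞) ?_ (by simp)
  refine (hproj.isSubmersionAt d).contMDiffAt_of_comp ?_
  exact (hproj.contMDiff.comp (contMDiff_mul_left (a := a))).contMDiffAt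

omit [LieGroup 𝓘(ℝ, E) ∞ D] [IsManifold 𝓘(ℝ, F) ∞ (D ⧸ G)] in
theorem mdifferentiableAt_mk
    (hproj : Manifold.IsSubmersion 𝓘(ℝ, E) 𝓘(ℝ, F) ∞ (fun d : D => (d : D ⧸ G))) (d : D) :
    MDifferentiableAt 𝓘(ℝ, E) 𝓘(ℝ, F) (fun d : D => (d : D ⧸ G)) d :=
  hproj.contMDiff.contMDiffAt.mdifferentiableAt (by simp)

omit [IsManifold 𝓘(ℝ, F) ∞ (D ⧸ G)] in
theorem dProj_rightTranslate
    (hproj : Manifold.IsSubmersion 𝓘(ℝ, E) 𝓘(ℝ, F) ∞ (fun d : D => (d : D ⧸ G)))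
    (d : D) (z : GroupLieAlgebra 𝓘(ℝ, E) D) :
    dProj E F G d (rightTranslate d z) = dressing E F (d : D ⧸ G) z :=
  (mfderiv_comp_apply_model (mdifferentiableAt_mk hproj d) (mdifferentiableAt_mul_right d 1)
    (one_mul d) rfl z).symm

/-- Since `π₀(h x) = (h d⁻¹) ▷ π₀(d x)`, a vector killed at one point of `D` is killed at every
point. -/
theorem dProj_leftTranslate_eq_zero
    (hproj : Manifold.IsSubmersion 𝓘(ℝ, E) 𝓘(ℝ, F) ∞ (fun d : D => (d : D ⧸ G)))
    {d : D} {v : GroupLieAlgebra 𝓘(ℝ, E) D} (hv : dProj E F G d (leftTranslate d v) = 0) (h : D) :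
    dProj E F G h (leftTranslate h v) = 0 := by
  have h1 (a : D) := mfderiv_comp_apply_model (h := fun x : D => ((a * x : D) : D ⧸ G))
    (mdifferentiableAt_mk hproj a) (mdifferentiableAt_mul_left a 1) (mul_one a) rfl v
  have hd : MDifferentiableAt 𝓘(ℝ, E) 𝓘(ℝ, F) (fun x : D => ((d * x : D) : D ⧸ G)) 1 :=
    (mdifferentiableAt_mk hproj _).comp 1 (mdifferentiableAt_mul_left d 1)
  have h2 := mfderiv_comp_apply_model (h := fun x : D => ((h * x : D) : D ⧸ G))
    (mdifferentiableAt_smul_quotient hproj (h * d⁻¹) ((d * 1 : D) : D ⧸ G)) hd rfl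
    (by
      ext x
      exact congrArg (fun y : D => (y : D ⧸ G)) (by simp [mul_assoc] : h * d⁻¹ * (d * x) = h * x)) v
  rw [h1 d] at h2
  refine ((h1 h).symm.trans h2).trans ?_
  refine Eq.trans (congrArg _ hv) (map_zero _)

/-- If `v` is killed at `d`, it is killed all along its integral curve through `1`. The projected
curve is then constant, so the curve stays in `G`. Conversely, a curve in `G` projects to a point,
and its velocity at time `0` is killed. -/
theorem dProj_leftTranslate_eq_zero_iff [CompleteSpace E] [T2Space D]
    (hproj : Manifold.IsSubmersion 𝓘(ℝ, E) 𝓘(ℝ, F) ∞ (fun d : D => (d : D ⧸ G)))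
    (hg : IsLieSubalgebraOf G g) (d : D) (v : GroupLieAlgebra 𝓘(ℝ, E) D) :
    dProj E F G d (leftTranslate d v) = 0 ↔ v ∈ g := by
  have hcomp (γ : ℝ → D) (t : ℝ)
      (hγ : IsMIntegralCurve (I := 𝓘(ℝ, E)) γ (mulInvariantVectorField v)) :=
    (mdifferentiableAt_mk hproj (γ t)).hasMFDerivAt.comp t (hγ t)
  have happ (h : D) (L : ℝ →L[ℝ] F)
      (hL : (mfderiv 𝓘(ℝ, E) 𝓘(ℝ, F) (fun d : D => (d : D ⧸ G)) h).comp
        ((1 : ℝ →L[ℝ] ℝ).smulRight (mulInvariantVectorField v h)) = L) :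
      L 1 = dProj E F G h (leftTranslate h v) := by
    subst hL
    change dProj E F G h ((1 : ℝ) • leftTranslate h v) = _
    rw [one_smul]
  constructor
  · intro hv
    obtain ⟨γ, hγ0, hγ⟩ := exists_isMIntegralCurve_mulInvariantVectorField v (1 : D)
    refine (hg v).2 ⟨γ, hγ0, hγ, fun t => ?_⟩
    have : IsManifold 𝓘(ℝ, F) 1 (D ⧸ G) := .of_le (n := ∞) (by simp)
    have h0 (t : ℝ) : HasMFDerivAt 𝓘(ℝ, ℝ) 𝓘(ℝ, F) (fun t => (γ t : D ⧸ G)) t 0 := by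
      have h1 := hcomp γ t hγ
      have h2 : (mfderiv 𝓘(ℝ, E) 𝓘(ℝ, F) (fun d : D => (d : D ⧸ G)) (γ t)).comp
        ((1 : ℝ →L[ℝ] ℝ).smulRight (mulInvariantVectorField v (γ t))) = 0 :=
        ContinuousLinearMap.ext_ring
          ((happ (γ t) _ rfl).trans (dProj_leftTranslate_eq_zero hproj hv (γ t)))
      exact h2 ▸ h1
    have h3 := eq_of_hasMFDerivAt_zero h0 0 t
    rw [hγ0, QuotientGroup.eq] at h3
    simpa using h3
  · intro hv
    obtain ⟨γ, hγ0, hγ, hγG⟩ := (hg v).1 hv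
    have h1 := hcomp γ 0 hγ
    have h2 : (fun d : D => (d : D ⧸ G)) ∘ γ = fun _ => ((1 : D) : D ⧸ G) := by
      ext t
      exact QuotientGroup.eq.2 (by simpa using hγG t)
    rw [h2] at h1
    have h3 := hasMFDerivAt_unique h1 (hasMFDerivAt_const _ _)
    have h4 := happ (γ 0) 0 h3
    exact dProj_leftTranslate_eq_zero hproj h4.symm d

theorem dressing_eq_zero_iff [CompleteSpace E] [T2Space D]
    (hproj : Manifold.IsSubmersion 𝓘(ℝ, E) 𝓘(ℝ, F) ∞ (fun d : D => (d : D ⧸ G)))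
    (hg : IsLieSubalgebraOf G g) (d : D) (z : GroupLieAlgebra 𝓘(ℝ, E) D) :
    dressing E F (d : D ⧸ G) z = 0 ↔ z ∈ g.map (Ad d) := by
  rw [← dProj_rightTranslate hproj, Submodule.mem_map]
  constructor
  · intro h
    obtain ⟨w, hw⟩ := (leftTranslate_bijective (E := E) d).2 (rightTranslate d z)
    rw [← hw, dProj_leftTranslate_eq_zero_iff hproj hg] at h
    refine ⟨w, h, (rightTranslate_bijective d).1 ?_⟩
    rw [rightTranslate_Ad, hw]
  · rintro ⟨w, hw, rfl⟩
    rwa [rightTranslate_Ad, dProj_leftTranslate_eq_zero_iff hproj hg]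

theorem dressing_surjective
    (hproj : Manifold.IsSubmersion 𝓘(ℝ, E) 𝓘(ℝ, F) ∞ (fun d : D => (d : D ⧸ G))) (s : D ⧸ G) :
    Function.Surjective (dressing E F s) := by
  obtain ⟨d, rfl⟩ := QuotientGroup.mk_surjective s
  intro w
  obtain ⟨v, hv⟩ := (hproj.isSubmersionAt d).mfderiv_surjective (by simp) w
  obtain ⟨z, rfl⟩ := (rightTranslate_bijective (E := E) d).2 v
  exact ⟨z, (dProj_rightTranslate hproj d z).symm.trans hv⟩

/-- A surjective linear map restricts to an isomorphism on any complement of its kernel, here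
`j(g*)` against `Ad_d(g)`. -/
theorem genVec_bijective [CompleteSpace E] [T2Space D]
    (hproj : Manifold.IsSubmersion 𝓘(ℝ, E) 𝓘(ℝ, F) ∞ (fun d : D => (d : D ⧸ G)))
    (hg : IsLieSubalgebraOf G g) (hj : Function.Injective j) {s : D ⧸ G}
    (hadm : IsAdmissibleAt G j s) : Function.Bijective (genVec F j s) := by
  obtain ⟨d, rfl⟩ := QuotientGroup.mk_surjective s
  have hd := hadm d rfl
  constructor
  · rw [injective_iff_map_eq_zero]
    intro ξ hξ
    have h1 : j ξ ∈ g.map (Ad d) := (dressing_eq_zero_iff hproj hg d (j ξ)).1 hξ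
    exact (map_eq_zero_iff j hj).1
      (Submodule.disjoint_def.1 hd.disjoint _ h1 (LinearMap.mem_range_self j ξ))
  · intro w
    obtain ⟨z, rfl⟩ := dressing_surjective hproj _ w
    obtain ⟨u, hu, _, ⟨ξ, rfl⟩, rfl⟩ := Submodule.mem_sup.1 (hd.codisjoint.eq_top ▸
      Submodule.mem_top : z ∈ g.map (Ad d) ⊔ LinearMap.range j)
    refine ⟨ξ, ?_⟩
    rw [map_add, (dressing_eq_zero_iff hproj hg d u).2 hu, zero_add]
    rfl

omit [LieGroup 𝓘(ℝ, E) ∞ D] [IsManifold 𝓘(ℝ, F) ∞ (D ⧸ G)] in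
theorem genForm_genVec {s : D ⧸ G} (h : Function.Bijective (genVec F j s)) (x : g)
    (ξ : Module.Dual ℝ g) : genForm F j s x (genVec F j s ξ) = ξ x := by
  rw [genForm, dif_pos h]
  exact congrArg (fun η : Module.Dual ℝ g => η x)
    ((LinearEquiv.ofBijective (genVec F j s) h).symm_apply_apply ξ)

theorem PiS_eq_PiD [CompleteSpace E] [T2Space D]
    (hproj : Manifold.IsSubmersion 𝓘(ℝ, E) 𝓘(ℝ, F) ∞ (fun d : D => (d : D ⧸ G)))
    (hg : IsLieSubalgebraOf G g) (d : D)
    (α β : Module.Dual ℝ (TangentSpace 𝓘(ℝ, F) (d : D ⧸ G))) :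
    PiS F j (d : D ⧸ G) α β = PiD j d (α ∘ₗ dProj E F G d) (β ∘ₗ dProj E F G d) := by
  -- The first leg of `r^L` consists of left translates of `g`, which are tangent to the fibres of
  -- `π₀`.
  have hL : g.subtype.dualMap ((leftTranslate d).dualMap (α ∘ₗ dProj E F G d)) = 0 := by
    ext x
    change α (dProj E F G d (leftTranslate d x)) = 0
    rw [(dProj_leftTranslate_eq_zero_iff hproj hg d _).2 x.2, map_zero]
  have hR (β : Module.Dual ℝ (TangentSpace 𝓘(ℝ, F) (d : D ⧸ G))) :
      (rightTranslate d).dualMap (β ∘ₗ dProj E F G d) = (dressing E F (d : D ⧸ G)).dualMap β :=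
    LinearMap.ext fun z => congrArg β (dProj_rightTranslate hproj d z)
  have e1 : rMatrix g j ((leftTranslate d).dualMap (α ∘ₗ dProj E F G d)) = 0 := by
    rw [rMatrix, LinearMap.comp_apply, hL, map_zero]
  simp only [PiS, PiD, LinearMap.neg_apply, LinearMap.sub_apply, LinearMap.compl₁₂_apply, hR, e1,
    LinearMap.zero_apply, zero_sub]

omit [LieGroup 𝓘(ℝ, E) ∞ D] [IsManifold 𝓘(ℝ, F) ∞ (D ⧸ G)] in
-- Pulling `y^▷` back along `ξ ↦ ξ^▷` gives evaluation at `y`. The second leg of `r` therefore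
-- evaluates the first, `iᵀ` of the pulled-back `x^▷`, at `y`.
theorem PiMap_apply {s : D ⧸ G} (h : Function.Bijective (genVec F j s)) (x y : g) :
    PiMap F j s y x = -genForm F j s x (dressing E F s y) := by
  exact congrArg Neg.neg (genForm_genVec h y
    (g.subtype.dualMap ((dressing E F s).dualMap (genForm F j s x))))

end Quotient

/-! ### Blocks of the adjoint action and the formula for `Π` -/

section Blocks

variable {E : Type*} [NormedAddCommGroup E] [NormedSpace ℝ E]
  {F : Type*} [NormedAddCommGroup F] [NormedSpace ℝ F]
  {D : Type*} [TopologicalSpace D] [ChartedSpace E D] [Group D]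
  {B : LinearMap.BilinForm ℝ (GroupLieAlgebra 𝓘(ℝ, E) D)}
  {g : Submodule ℝ (GroupLieAlgebra 𝓘(ℝ, E) D)}
  {j : Module.Dual ℝ g →ₗ[ℝ] GroupLieAlgebra 𝓘(ℝ, E) D}

theorem AdSplit_inl (hB : IsManinPair B g) (hj : IsIsotropicSplitting B g j) (d : D) (x : g) :
    AdSplit hB hj d (x, 0) =
      (splitEquiv hB.lagrangian hj).symm (Ad d (x : GroupLieAlgebra 𝓘(ℝ, E) D)) := by
  have h2 : splitEquiv hB.lagrangian hj (x, 0) = (x : GroupLieAlgebra 𝓘(ℝ, E) D) :=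
    (congrArg ((x : GroupLieAlgebra 𝓘(ℝ, E) D) + ·) (map_zero j)).trans (add_zero _)
  rw [← h2]
  rfl

theorem Ad_eq_kBlock_add_cBlock (hB : IsManinPair B g) (hj : IsIsotropicSplitting B g j) (d : D)
    (x : g) : Ad d (x : GroupLieAlgebra 𝓘(ℝ, E) D) =
      (kBlock hB hj d x : GroupLieAlgebra 𝓘(ℝ, E) D) + j (cBlock hB hj d x) := by
  refine ((splitEquiv hB.lagrangian hj).apply_symm_apply _).symm.trans ?_
  rw [← AdSplit_inl hB hj]
  rfl

variable [LieGroup 𝓘(ℝ, E) ∞ D] {G : Subgroup D}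

/-- If `k(d) x = 0`, then `Ad_d x` lies in both `Ad_d(g)` and `j(g*)`, which meet only in `0`. -/
theorem kBlock_injective (hB : IsManinPair B g) (hj : IsIsotropicSplitting B g j) {d : D}
    (hadm : IsAdmissibleAt G j (d : D ⧸ G)) : Function.Injective (kBlock hB hj d) := by
  rw [injective_iff_map_eq_zero]
  intro x hx
  have h1 := Ad_eq_kBlock_add_cBlock hB hj d x
  rw [hx, Submodule.coe_zero, zero_add] at h1
  have h2 := Submodule.disjoint_def.1 (hadm d rfl).disjoint _
    (Submodule.mem_map_of_mem x.2) (h1 ▸ LinearMap.mem_range_self j _)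
  exact Subtype.ext (Ad_injective d (h2.trans (map_zero _).symm))

/-- The block `k(d)` as a linear automorphism of `g`. -/
noncomputable def kEquiv [FiniteDimensional ℝ E] (hB : IsManinPair B g)
    (hj : IsIsotropicSplitting B g j) {d : D} (hadm : IsAdmissibleAt G j (d : D ⧸ G)) : g ≃ₗ[ℝ] g :=
  haveI : FiniteDimensional ℝ (GroupLieAlgebra 𝓘(ℝ, E) D) := inferInstanceAs (FiniteDimensional ℝ E)
  LinearEquiv.ofInjectiveEndo (kBlock hB hj d) (kBlock_injective hB hj hadm)

theorem PiMap_eq_cBlock_comp_kEquiv_symm [FiniteDimensional ℝ E] [T2Space D]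
    [ChartedSpace F (D ⧸ G)] [IsManifold 𝓘(ℝ, F) ∞ (D ⧸ G)]
    (hproj : Manifold.IsSubmersion 𝓘(ℝ, E) 𝓘(ℝ, F) ∞ (fun d : D => (d : D ⧸ G)))
    (hg : IsLieSubalgebraOf G g) (hB : IsManinPair B g) (hj : IsIsotropicSplitting B g j) {d : D}
    (hadm : IsAdmissibleAt G j (d : D ⧸ G)) :
    PiMap F j (d : D ⧸ G) = cBlock hB hj d ∘ₗ ((kEquiv hB hj hadm).symm : g →ₗ[ℝ] g) := by
  have : CompleteSpace E := FiniteDimensional.complete ℝ E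
  have hbij : Function.Bijective (genVec F j (d : D ⧸ G)) :=
    genVec_bijective hproj hg
      (Function.LeftInverse.injective (g := q B g) fun ξ => LinearMap.congr_fun hj.q_comp ξ) hadm
  refine LinearMap.ext fun y => LinearMap.ext fun x => ?_
  -- With `y = k w` it remains to compute `#(k w)`, which the vanishing of `#` on `Ad_d w`
  -- determines.
  obtain ⟨w, rfl⟩ := (kEquiv hB hj hadm).surjective y
  rw [PiMap_apply hbij, LinearMap.comp_apply, LinearEquiv.coe_coe, LinearEquiv.symm_apply_apply]
  have h1 : dressing E F (d : D ⧸ G) (Ad d (w : GroupLieAlgebra 𝓘(ℝ, E) D)) = 0 :=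
    (dressing_eq_zero_iff hproj hg d _).2 (Submodule.mem_map_of_mem w.2)
  rw [Ad_eq_kBlock_add_cBlock hB hj, map_add] at h1
  have h2 : dressing E F (d : D ⧸ G) (kEquiv hB hj hadm w : GroupLieAlgebra 𝓘(ℝ, E) D) =
      -genVec F j (d : D ⧸ G) (cBlock hB hj d w) := eq_neg_of_add_eq_zero_left h1
  rw [h2, map_neg, neg_neg, genForm_genVec hbij]

end Blocks

/-! ### Smoothness of the blocks and of `c k⁻¹` -/

section Smoothness

variable {E : Type*} [NormedAddCommGroup E] [NormedSpace ℝ E] [FiniteDimensional ℝ E]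
  {D : Type*} [TopologicalSpace D] [ChartedSpace E D] [Group D] [LieGroup 𝓘(ℝ, E) ∞ D]
  {B : LinearMap.BilinForm ℝ (GroupLieAlgebra 𝓘(ℝ, E) D)}
  {g : Submodule ℝ (GroupLieAlgebra 𝓘(ℝ, E) D)}
  {j : Module.Dual ℝ g →ₗ[ℝ] GroupLieAlgebra 𝓘(ℝ, E) D}

theorem contMDiff_Ad_apply (ℓ : GroupLieAlgebra 𝓘(ℝ, E) D →ₗ[ℝ] ℝ)
    (v : GroupLieAlgebra 𝓘(ℝ, E) D) :
    ContMDiff 𝓘(ℝ, E) 𝓘(ℝ, ℝ) ∞ (fun d : D => ℓ (Ad d v)) := by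
  let ℓ' : E →ₗ[ℝ] ℝ := ℓ
  let v' : E := v
  have h1 : ContMDiff 𝓘(ℝ, E) 𝓘(ℝ, ℝ) ∞ (fun d : D => ℓ'.toContinuousLinearMap
      ((mfderiv 𝓘(ℝ, E) 𝓘(ℝ, E) (fun h : D => d * h * d⁻¹) 1 : E →L[ℝ] E) v')) :=
    ℓ'.toContinuousLinearMap.contMDiff.comp (contMDiff_Ad.clm_apply contMDiff_const)
  exact h1

theorem contMDiff_kBlock (hB : IsManinPair B g) (hj : IsIsotropicSplitting B g j) (x : g)
    (ξ : Module.Dual ℝ g) :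
    ContMDiff 𝓘(ℝ, E) 𝓘(ℝ, ℝ) ∞ (fun d : D => ξ (kBlock hB hj d x)) := by
  have h1 := contMDiff_Ad_apply (D := D) (ξ ∘ₗ LinearMap.fst ℝ g (Module.Dual ℝ g) ∘ₗ
    (splitEquiv hB.lagrangian hj).symm.toLinearMap) (x : GroupLieAlgebra 𝓘(ℝ, E) D)
  refine h1.congr fun d => ?_
  exact congrArg (fun p => ξ (Prod.fst p)) (AdSplit_inl hB hj d x)

theorem contMDiff_cBlock (hB : IsManinPair B g) (hj : IsIsotropicSplitting B g j) (x y : g) :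
    ContMDiff 𝓘(ℝ, E) 𝓘(ℝ, ℝ) ∞ (fun d : D => cBlock hB hj d x y) := by
  have h1 := contMDiff_Ad_apply (D := D) (Module.Dual.eval ℝ g y ∘ₗ
    LinearMap.snd ℝ g (Module.Dual ℝ g) ∘ₗ (splitEquiv hB.lagrangian hj).symm.toLinearMap)
    (x : GroupLieAlgebra 𝓘(ℝ, E) D)
  refine h1.congr fun d => ?_
  exact congrArg (fun p => (Prod.snd p) y) (AdSplit_inl hB hj d x)

/-- In a basis of `g`, `k` becomes a smooth family of invertible operators on the normed space `W`,
and inversion is smooth at such operators. The vector `k⁻¹ y` is then fed back into `Ad_d`, whose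
`g*`-component is `c(k⁻¹ y)`. -/
theorem contMDiff_cBlock_kEquiv_symm {G : Subgroup D} (hB : IsManinPair B g)
    (hj : IsIsotropicSplitting B g j) (hadm : ∀ s : D ⧸ G, IsAdmissibleAt G j s) (x y : g) :
    ContMDiff 𝓘(ℝ, E) 𝓘(ℝ, ℝ) ∞
      (fun d : D => cBlock hB hj d ((kEquiv hB hj (hadm (d : D ⧸ G))).symm y) x) := by
  have : FiniteDimensional ℝ (GroupLieAlgebra 𝓘(ℝ, E) D) :=
    inferInstanceAs (FiniteDimensional ℝ E)
  let W := Fin (Module.finrank ℝ g) → ℝ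
  let e : g ≃ₗ[ℝ] W := (Module.finBasis ℝ g).equivFun
  let P : E →ₗ[ℝ] W := (e.toLinearMap ∘ₗ LinearMap.fst ℝ g (Module.Dual ℝ g) ∘ₗ
    (splitEquiv hB.lagrangian hj).symm.toLinearMap : GroupLieAlgebra 𝓘(ℝ, E) D →ₗ[ℝ] W)
  let ι : W →ₗ[ℝ] E :=
    (g.subtype ∘ₗ e.symm.toLinearMap : W →ₗ[ℝ] GroupLieAlgebra 𝓘(ℝ, E) D)
  let ℓ : E →ₗ[ℝ] ℝ := (Module.Dual.eval ℝ g x ∘ₗ LinearMap.snd ℝ g (Module.Dual ℝ g) ∘ₗ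
    (splitEquiv hB.lagrangian hj).symm.toLinearMap : GroupLieAlgebra 𝓘(ℝ, E) D →ₗ[ℝ] ℝ)
  let A : D → E →L[ℝ] E := fun d => mfderiv 𝓘(ℝ, E) 𝓘(ℝ, E) (fun h : D => d * h * d⁻¹) 1
  have hA : ContMDiff 𝓘(ℝ, E) 𝓘(ℝ, E →L[ℝ] E) ∞ A := contMDiff_Ad
  let K : D → W →L[ℝ] W := fun d =>
    P.toContinuousLinearMap ∘L A d ∘L ι.toContinuousLinearMap
  have hK : ContMDiff 𝓘(ℝ, E) 𝓘(ℝ, W →L[ℝ] W) ∞ K :=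
    contMDiff_const.clm_comp (hA.clm_comp contMDiff_const)
  let k (d : D) : W ≃L[ℝ] W :=
    (e.symm.trans ((kEquiv hB hj (hadm (d : D ⧸ G))).trans e)).toContinuousLinearEquiv
  have hk (d : D) : K d = k d := by
    refine ContinuousLinearMap.ext fun w => ?_
    exact congrArg (fun p => e (Prod.fst p)) (AdSplit_inl hB hj d (e.symm w)).symm
  have hinv : ContMDiff 𝓘(ℝ, E) 𝓘(ℝ, W →L[ℝ] W) ∞ (fun d => (K d).inverse) := fun d => by
    have h1 : ContDiffAt ℝ ∞ ContinuousLinearMap.inverse (K d) := by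
      rw [hk]
      exact contDiffAt_map_inverse (k d)
    exact h1.contMDiffAt.comp d hK.contMDiffAt
  have h2 : ContMDiff 𝓘(ℝ, E) 𝓘(ℝ, ℝ) ∞ (fun d => ℓ.toContinuousLinearMap
      (A d (ι.toContinuousLinearMap ((K d).inverse (e y))))) :=
    ℓ.toContinuousLinearMap.contMDiff.comp (hA.clm_apply
      (ι.toContinuousLinearMap.contMDiff.comp (hinv.clm_apply contMDiff_const)))
  refine h2.congr fun d => ?_
  have h3 : (K d).inverse (e y) = e ((kEquiv hB hj (hadm (d : D ⧸ G))).symm y) := by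
    rw [hk, ContinuousLinearMap.inverse_equiv]
    change e ((kEquiv hB hj (hadm (d : D ⧸ G))).symm (e.symm (e y))) = _
    rw [e.symm_apply_apply]
  rw [h3]
  have h4 : ι.toContinuousLinearMap (e ((kEquiv hB hj (hadm (d : D ⧸ G))).symm y)) =
      ((kEquiv hB hj (hadm (d : D ⧸ G))).symm y : GroupLieAlgebra 𝓘(ℝ, E) D) :=
    congrArg Subtype.val (e.symm_apply_apply _)
  rw [h4]
  exact congrArg (fun p => (Prod.snd p) x) (AdSplit_inl hB hj d _)

end Smoothness

end ManinPair

theorem mainTheorem6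
    {E : Type*} [NormedAddCommGroup E] [NormedSpace ℝ E] [FiniteDimensional ℝ E]
    {F : Type*} [NormedAddCommGroup F] [NormedSpace ℝ F] [FiniteDimensional ℝ F]
    {D : Type*} [TopologicalSpace D] [ChartedSpace E D] [Group D] [LieGroup 𝓘(ℝ, E) ∞ D]
    [T2Space D] [ConnectedSpace D]
    (G : Subgroup D) (hGclosed : IsClosed (G : Set D)) (hGconn : IsConnected (G : Set D))
    [ChartedSpace F (D ⧸ G)] [IsManifold 𝓘(ℝ, F) ∞ (D ⧸ G)]
    (hproj : Manifold.IsSubmersion 𝓘(ℝ, E) 𝓘(ℝ, F) ∞ (fun d : D => (d : D ⧸ G)))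
    (B : LinearMap.BilinForm ℝ (GroupLieAlgebra 𝓘(ℝ, E) D))
    (g : Submodule ℝ (GroupLieAlgebra 𝓘(ℝ, E) D))
    (hg : ManinPair.IsLieSubalgebraOf G g)
    (hB : ManinPair.IsManinPair B g)
    (j : Module.Dual ℝ g →ₗ[ℝ] GroupLieAlgebra 𝓘(ℝ, E) D)
    (hj : ManinPair.IsIsotropicSplitting B g j)
    (hadm : ∀ s : D ⧸ G, ManinPair.IsAdmissibleAt G j s) :
    -- at every point the vector fields `ξ^▷` form a copy of `g*`, and `x^▷` is the dual form
    (∀ s : D ⧸ G, Function.Bijective (ManinPair.genVec F j s) ∧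
      ∀ (x : g) (ξ : Module.Dual ℝ g),
        ManinPair.genForm F j s x (ManinPair.genVec F j s ξ) = ξ x) ∧
    -- `Π^S` is the push-forward of `Π^D` along `π₀`
    (∀ (d : D) (α β : Module.Dual ℝ (TangentSpace 𝓘(ℝ, F) (d : D ⧸ G))),
      ManinPair.PiS F j (d : D ⧸ G) α β =
        ManinPair.PiD j d (α ∘ₗ ManinPair.dProj E F G d) (β ∘ₗ ManinPair.dProj E F G d)) ∧
    -- `k`, `c` and `Π` are smooth (all their matrix coefficients are)
    (∀ (x : g) (ξ : Module.Dual ℝ g),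
      ContMDiff 𝓘(ℝ, E) 𝓘(ℝ, ℝ) ∞ (fun d : D => ξ (ManinPair.kBlock hB hj d x))) ∧
    (∀ x y : g, ContMDiff 𝓘(ℝ, E) 𝓘(ℝ, ℝ) ∞ (fun d : D => ManinPair.cBlock hB hj d x y)) ∧
    (∀ x y : g, ContMDiff 𝓘(ℝ, F) 𝓘(ℝ, ℝ) ∞ (fun s : D ⧸ G => ManinPair.PiMap F j s x y)) ∧
    -- `k(d)` is invertible and `Π (π₀ d) = c(d) k(d)⁻¹`
    ∀ d : D, ∃ K : g ≃ₗ[ℝ] g, (K : g →ₗ[ℝ] g) = ManinPair.kBlock hB hj d ∧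
      ManinPair.PiMap F j (d : D ⧸ G) =
        ManinPair.cBlock hB hj d ∘ₗ (K.symm : g →ₗ[ℝ] g) := by

  have : CompleteSpace E := FiniteDimensional.complete ℝ E
  have hbij (s : D ⧸ G) : Function.Bijective (ManinPair.genVec F j s) :=
    ManinPair.genVec_bijective hproj hg (Function.LeftInverse.injective (g := ManinPair.q B g)
      fun ξ => LinearMap.congr_fun hj.q_comp ξ) (hadm s)
  refine ⟨fun s => ⟨hbij s, ManinPair.genForm_genVec (hbij s)⟩, ManinPair.PiS_eq_PiD hproj hg,
    ManinPair.contMDiff_kBlock hB hj, ManinPair.contMDiff_cBlock hB hj, fun x y s => ?_,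
    fun d => ⟨ManinPair.kEquiv hB hj (hadm _), rfl,
      ManinPair.PiMap_eq_cBlock_comp_kEquiv_symm hproj hg hB hj (hadm _)⟩⟩
  obtain ⟨d, rfl⟩ := QuotientGroup.mk_surjective s
  -- Smoothness of `Π` on the quotient is tested after pull-back to `D`, where it equals `c k⁻¹`.
  refine (hproj.isSubmersionAt d).contMDiffAt_of_comp
    (u := fun s : D ⧸ G => ManinPair.PiMap F j s x y) ?_
  refine ((ManinPair.contMDiff_cBlock_kEquiv_symm hB hj hadm y x).congr fun d => ?_).contMDiffAt
  exact congrArg (fun T : g →ₗ[ℝ] Module.Dual ℝ g => T x y)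
    (ManinPair.PiMap_eq_cBlock_comp_kEquiv_symm hproj hg hB hj (hadm (d : D ⧸ G)))
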